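/- Let $P(s),S(s)\in\mathbb{R}[s]^{m\times m}$ satisfy $P^\top(-s)S(s)-S^\top(-s)P(s)=0$ and $\operatorname{rank}\begin{bmatrix}P(s)\\ S(s)\end{bmatrix}=m$ for all $s\in\mathbb{C}$. Let $J_i=\begin{bmatrix}0&I_p\\-I_p&0\end{bmatrix}$, and let $W(s)\in\mathbb{R}[s]^{2p\times m}$ give a minimal factorization $$P^\top(\zeta)S(\eta)-S^\top(\zeta)P(\eta)=(\zeta+\eta)\,W^\top(\zeta)J_iW(\eta),$$ where minimal means that the number $2p$ of rows of $W$ equals the rank of the coefficient matrix of the two-variable polynomial matrix $W^\top(\zeta)J_iW(\eta)=\sum_{k,l}\Phi_{k,l}\zeta^k\eta^l$, i.e. of the block matrix $(\Phi_{k,l})_{k,l\ge 0}$. Then for all real $\alpha<\beta$ the following holds. Consider the space of all tuples $\big((x,e),(x_\delta(\alpha),e_\delta(\alpha)),(x_\delta(\beta),e_\delta(\beta))\big)$ with $x,e\in C^\infty([\alpha,\beta],\mathbb{R}^m)$ and $x_\delta(\alpha),e_\delta(\alpha),x_\delta(\beta),e_\delta(\beta)\in\mathbb{R}^p$, with the bilinear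 form $$\int_\alpha^\beta \big(e_1^\top x_2-e_2^\top x_1\big)\,dz+x_{\delta1}^\top(\beta)e_{\delta2}(\beta)-e_{\delta1}^\top(\beta)x_{\delta2}(\beta)-x_{\delta1}^\top(\alpha)e_{\delta2}(\alpha)+e_{\delta1}^\top(\alpha)x_{\delta2}(\alpha).$$ This form is symplectic (alternating and non-degenerate), and the subspace $\mathcal{L}$ of those tuples that satisfy $$S^\top(-\tfrac{d}{dz})x(z)-P^\top(-\tfrac{d}{dz})e(z)=0,\quad z\in[\alpha,\beta],$$ and for which there is $\ell\in C^\infty([\alpha,\beta],\mathbb{R}^m)$ with $$\begin{bmatrix}x\\ e\end{bmatrix}=\begin{bmatrix}P(\frac{d}{dz})\\ S(\frac{d}{dz})\end{bmatrix}\ell \ \text{ on } [\alpha,\beta],\qquad \begin{bmatrix}x_\delta(\alpha)\\ e_\delta(\alpha)\end{bmatrix}=\big(W(\tfrac{d}{dz})\ell\big)(\alpha),\qquad \begin{bmatrix}x_\delta(\beta)\\ e_\delta(\beta)\end{bmatrix}=\big(W(\tfrac{d}{dz})\ell\big)(\beta)$$ is Lagrangian: $\mathcal{L}=\mathcal{L}^{\perp}$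 with respect to this form. -/

import Mathlib

open scoped ContDiff
open Polynomial Matrix Set

noncomputable section

namespace DiffLagrangian

/-! ### Smooth functions on a compact interval and differential operators -/

/-- The real vector space of smooth real functions on `[α, β]` (all one-sided derivatives exist
and are continuous up to the end points). -/
def Smooth {α β : ℝ} (h : α < β) : Submodule ℝ (Icc α β → ℝ) where
  carrier := {f | ContDiffOn ℝ ∞ (IccExtend h.le f) (Icc α β)}
  add_mem' := fun {f g} hf hg => (ContDiffOn.add hf hg :)
  zero_mem' := (contDiff_zero_fun (𝕜 := ℝ) (E := ℝ) (F := ℝ)).contDiffOn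
  smul_mem' := fun c f hf => by
    have hf' : ContDiffOn ℝ ∞ (IccExtend h.le f) (Icc α β) := hf
    exact hf'.const_smul c

/-- The derivative `d/dz` on smooth functions on `[α, β]` (one-sided at the end points). -/
def D {α β : ℝ} (h : α < β) : Smooth h →ₗ[ℝ] Smooth h where
  toFun f := ⟨fun z => derivWithin (IccExtend h.le f.1) (Icc α β) z, by
    have h1 : ContDiffOn ℝ ∞ (derivWithin (IccExtend h.le f.1) (Icc α β)) (Icc α β) :=
      f.2.derivWithin (uniqueDiffOn_Icc h) (by simp)
    refine h1.congr fun z hz => ?_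
    rw [IccExtend_of_mem h.le _ hz]⟩
  map_add' f g := by
    ext z
    have hf := (f.2.differentiableOn (by simp)) z z.2
    have hg := (g.2.differentiableOn (by simp)) z z.2
    exact derivWithin_add hf hg
  map_smul' c f := by
    ext z
    have hf := (f.2.differentiableOn (by simp)) z z.2
    exact derivWithin_const_smul c hf

/-- The value at `z` of a vector of smooth functions on `[α, β]` (for `z` outside of `[α, β]`, the
value at the nearest end point). -/
def valueAt {α β : ℝ} (h : α < β) {ι : Type*} (z : ℝ) : (ι → Smooth h) →ₗ[ℝ] (ι → ℝ) where
  toFun u := fun i => IccExtend h.le (u i).1 z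
  map_add' _ _ := rfl
  map_smul' _ _ := rfl

/-- The linear differential operator `M(d/dz)` given by a real polynomial matrix `M(s)`. -/
def diffOp {α β : ℝ} (h : α < β) {ι κ : Type*} [Fintype κ] (M : Matrix ι κ ℝ[X]) :
    (κ → Smooth h) →ₗ[ℝ] (ι → Smooth h) :=
  LinearMap.pi fun i => ∑ j, (aeval (D h) (M i j)) ∘ₗ LinearMap.proj j

/-- The polynomial matrix `M(-s)`. -/
def atNeg {ι κ : Type*} (M : Matrix ι κ ℝ[X]) : Matrix ι κ ℝ[X] :=
  M.map fun q => q.comp (-X)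

/-- The complex matrix `M(s)`, for `s ∈ ℂ`. -/
def evalC {ι κ : Type*} (M : Matrix ι κ ℝ[X]) (s : ℂ) : Matrix ι κ ℂ :=
  M.map fun q => aeval s q

/-- The canonical symplectic matrix `[[0, I], [-I, 0]]`. -/
def canonJ (n : ℕ) (R : Type*) [Ring R] : Matrix (Fin n ⊕ Fin n) (Fin n ⊕ Fin n) R :=
  fromBlocks 0 1 (-1) 0

/-- The standing assumptions on the pair of square polynomial matrices `P(s), S(s)`. -/
structure IsLagrangianPair {m : ℕ} (P S : Matrix (Fin m) (Fin m) ℝ[X]) : Prop where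
  symm : ∀ s : ℂ, fromCols (evalC P (-s))ᵀ (evalC S (-s))ᵀ * canonJ m ℂ *
    fromRows (evalC P s) (evalC S s) = 0
  rank : ∀ s : ℂ, (fromRows (evalC P s) (evalC S s)).rank = m

/-! ### Two-variable polynomial matrices

Real polynomials in `ζ, η` are polynomials in `η` with coefficients in `ℝ[ζ]`. -/

/-- Real polynomials in two indeterminates `ζ, η`. -/
abbrev BiPoly : Type := Polynomial (Polynomial ℝ)

/-- The indeterminate `ζ`. -/
def zeta : BiPoly := C X

/-- The indeterminate `η`. -/
def eta : BiPoly := X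

/-- `M(ζ)`. -/
def atZeta {ι κ : Type*} (M : Matrix ι κ ℝ[X]) : Matrix ι κ BiPoly :=
  M.map fun q => aeval zeta q

/-- `M(η)`. -/
def atEta {ι κ : Type*} (M : Matrix ι κ ℝ[X]) : Matrix ι κ BiPoly :=
  M.map fun q => aeval eta q

/-- The (infinite) coefficient matrix of a two-variable polynomial matrix; its `(k, l)`-th block
is the matrix of coefficients of `ζ ^ k * η ^ l`. -/
def coeffMatrix {ι κ : Type*} (Φ : Matrix ι κ BiPoly) : Matrix (ℕ × ι) (ℕ × κ) ℝ :=
  Matrix.of fun a b => ((Φ a.2 b.2).coeff b.1).coeff a.1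

/-- The two-variable polynomial matrix `Wᵀ(ζ) J W(η)`. -/
def boundaryPoly {m p : ℕ} (W : Matrix (Fin p ⊕ Fin p) (Fin m) ℝ[X]) :
    Matrix (Fin m) (Fin m) BiPoly :=
  (atZeta W)ᵀ * canonJ p BiPoly * atEta W

/-- `W` gives a minimal factorization
`Pᵀ(ζ) S(η) - Sᵀ(ζ) P(η) = (ζ + η) Wᵀ(ζ) J W(η)`: minimal means that the number `2 p` of
rows of `W` is the rank of the coefficient matrix of the factorized polynomial matrix. -/
structure IsMinimalFactorization {m p : ℕ} (P S : Matrix (Fin m) (Fin m) ℝ[X])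
    (W : Matrix (Fin p ⊕ Fin p) (Fin m) ℝ[X]) : Prop where
  eq : (atZeta P)ᵀ * atEta S - (atZeta S)ᵀ * atEta P = (zeta + eta) • boundaryPoly W
  minimal : (coeffMatrix (boundaryPoly W)).cRank = ((2 * p : ℕ) : Cardinal)

/-! ### The extended space, its symplectic form, and the subspace of solutions -/

/-- Tuples `((x, e), (x_δ(α), e_δ(α)), (x_δ(β), e_δ(β)))`, with `x, e` smooth functions on
`[α, β]` with values in `ℝ^m` and boundary variables in `ℝ^p`. -/
abbrev ExtSpace {α β : ℝ} (h : α < β) (m p : ℕ) : Type :=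
  ((Fin m → Smooth h) × (Fin m → Smooth h)) ×
    ((Fin p → ℝ) × (Fin p → ℝ)) × ((Fin p → ℝ) × (Fin p → ℝ))

/-- The integrand `⟨e₁ | x₂⟩ - ⟨e₂ | x₁⟩` at the point `z`. -/
def density {α β : ℝ} (h : α < β) {m : ℕ}
    (u v : (Fin m → Smooth h) × (Fin m → Smooth h)) (z : ℝ) : ℝ :=
  valueAt h z u.2 ⬝ᵥ valueAt h z v.1 - valueAt h z v.2 ⬝ᵥ valueAt h z u.1

theorem continuous_valueAt {α β : ℝ} (h : α < β) {m : ℕ} (u : Fin m → Smooth h) :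
    Continuous fun z => valueAt h z u := by
  refine continuous_pi fun i => ?_
  have h1 : Continuous (u i).1 := by
    have h2 : ContinuousOn (IccExtend h.le (u i).1) (Icc α β) := (u i).2.continuousOn
    rw [continuousOn_iff_continuous_domRestrict] at h2
    convert h2 using 1
    ext z
    simp
  exact h1.Icc_extend'

theorem intervalIntegrable_density {α β : ℝ} (h : α < β) {m : ℕ}
    (u v : (Fin m → Smooth h) × (Fin m → Smooth h)) :
    IntervalIntegrable (density h u v) MeasureTheory.volume α β := by
  apply Continuous.intervalIntegrable
  exact ((continuous_valueAt h u.2).dotProduct (continuous_valueAt h v.1)).sub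
    ((continuous_valueAt h v.2).dotProduct (continuous_valueAt h u.1))

/-- The integrated symplectic form on pairs `(x, e)` of smooth functions on `[α, β]`. -/
def integralForm {α β : ℝ} (h : α < β) (m : ℕ) :
    LinearMap.BilinForm ℝ ((Fin m → Smooth h) × (Fin m → Smooth h)) :=
  LinearMap.mk₂ ℝ (fun u v => ∫ z in α..β, density h u v z)
    (fun u u' v => by
      rw [← intervalIntegral.integral_add (intervalIntegrable_density h u v)
        (intervalIntegrable_density h u' v)]
      congr 1; funext z
      simp only [density, Prod.fst_add, Prod.snd_add, map_add, add_dotProduct, dotProduct_add]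
      ring)
    (fun c u v => by
      rw [← intervalIntegral.integral_smul]
      congr 1; funext z
      simp only [density, Prod.smul_fst, Prod.smul_snd, map_smul, smul_dotProduct,
        dotProduct_smul, smul_eq_mul]
      ring)
    (fun u v v' => by
      rw [← intervalIntegral.integral_add (intervalIntegrable_density h u v)
        (intervalIntegrable_density h u v')]
      congr 1; funext z
      simp only [density, Prod.fst_add, Prod.snd_add, map_add, add_dotProduct, dotProduct_add]
      ring)
    (fun c u v => by
      rw [← intervalIntegral.integral_smul]
      congr 1; funext z
      simp only [density, Prod.smul_fst, Prod.smul_snd, map_smul, smul_dotProduct,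
        dotProduct_smul, smul_eq_mul]
      ring)

/-- The form on pairs of boundary variables, `x_δ₁ᵀ e_δ₂ - e_δ₁ᵀ x_δ₂`. -/
def boundaryForm (p : ℕ) : LinearMap.BilinForm ℝ ((Fin p → ℝ) × (Fin p → ℝ)) :=
  LinearMap.mk₂ ℝ (fun b c => b.1 ⬝ᵥ c.2 - b.2 ⬝ᵥ c.1)
    (fun b b' c => by
      simp only [Prod.fst_add, Prod.snd_add, add_dotProduct]; ring)
    (fun r b c => by
      simp only [Prod.smul_fst, Prod.smul_snd, smul_dotProduct, smul_eq_mul]; ring)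
    (fun b c c' => by
      simp only [Prod.fst_add, Prod.snd_add, dotProduct_add]; ring)
    (fun r b c => by
      simp only [Prod.smul_fst, Prod.smul_snd, dotProduct_smul, smul_eq_mul]; ring)

/-- The bilinear form on the extended space: the integrated symplectic form, plus the boundary
term at `β`, minus the boundary term at `α`. -/
def extForm {α β : ℝ} (h : α < β) (m p : ℕ) : LinearMap.BilinForm ℝ (ExtSpace h m p) :=
  LinearMap.mk₂ ℝ
    (fun v w => integralForm h m v.1 w.1 + boundaryForm p v.2.2 w.2.2 - boundaryForm p v.2.1 w.2.1)
    (fun v v' w => by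
      simp only [Prod.fst_add, Prod.snd_add, map_add, LinearMap.add_apply]; ring)
    (fun r v w => by
      simp only [Prod.smul_fst, Prod.smul_snd, map_smul, LinearMap.smul_apply, smul_eq_mul]; ring)
    (fun v w w' => by
      simp only [Prod.fst_add, Prod.snd_add, map_add]; ring)
    (fun r v w => by
      simp only [Prod.smul_fst, Prod.smul_snd, map_smul, smul_eq_mul]; ring)

/-- The space of all `(x, e)` on `[α, β]` and boundary variables at `α, β` with
`Sᵀ(-d/dz) x - Pᵀ(-d/dz) e = 0` on `[α, β]`, and such that there is a smooth `ℓ` on `[α, β]` with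
`x = P(d/dz) ℓ`, `e = S(d/dz) ℓ` on `[α, β]`, `(x_δ(α), e_δ(α)) = (W(d/dz) ℓ)(α)` and
`(x_δ(β), e_δ(β)) = (W(d/dz) ℓ)(β)`. -/
def solutionSpace {α β : ℝ} (h : α < β) {m p : ℕ} (P S : Matrix (Fin m) (Fin m) ℝ[X])
    (W : Matrix (Fin p ⊕ Fin p) (Fin m) ℝ[X]) : Submodule ℝ (ExtSpace h m p) where
  carrier := {v | diffOp h (atNeg S)ᵀ v.1.1 - diffOp h (atNeg P)ᵀ v.1.2 = 0 ∧
    ∃ l : Fin m → Smooth h, v.1.1 = diffOp h P l ∧ v.1.2 = diffOp h S l ∧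
      Sum.elim v.2.1.1 v.2.1.2 = valueAt h α (diffOp h W l) ∧
      Sum.elim v.2.2.1 v.2.2.2 = valueAt h β (diffOp h W l)}
  add_mem' := by
    rintro v w ⟨hv, l, h1, h2, h3, h4⟩ ⟨hw, k, k1, k2, k3, k4⟩
    refine ⟨?_, l + k, ?_, ?_, ?_, ?_⟩
    · have := congrArg₂ (· + ·) hv hw
      simp only [add_zero] at this
      rw [← this]
      simp only [Prod.fst_add, Prod.snd_add, map_add]
      abel
    · simp [h1, k1]
    · simp [h2, k2]
    · rw [map_add, map_add, ← h3, ← k3]; ext (i | i) <;> simp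
    · rw [map_add, map_add, ← h4, ← k4]; ext (i | i) <;> simp
  zero_mem' := by
    refine ⟨by simp, 0, by simp, by simp, ?_, ?_⟩ <;> ext (i | i) <;> simp
  smul_mem' := by
    rintro c v ⟨hv, l, h1, h2, h3, h4⟩
    refine ⟨?_, c • l, ?_, ?_, ?_, ?_⟩
    · have := congrArg (fun t => c • t) hv
      simp only [smul_sub, smul_zero, ← map_smul] at this
      exact this
    · simp [h1]
    · simp [h2]
    · rw [map_smul, map_smul, ← h3]; ext (i | i) <;> simp
    · rw [map_smul, map_smul, ← h4]; ext (i | i) <;> simp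

/-- `B` is a symplectic form on `V`, and the subspace `L` equals its orthogonal companion. -/
structure IsLagrangian {V : Type*} [AddCommGroup V] [Module ℝ V] (B : LinearMap.BilinForm ℝ V)
    (L : Submodule ℝ V) : Prop where
  alt : B.IsAlt
  nondegenerate : B.Nondegenerate
  eq_orthogonal : L = B.orthogonal L

end DiffLagrangian

end

noncomputable section

namespace DiffLagrangian

/-! ### Calculus of smooth functions on a compact interval -/

section Calculus

variable {α β : ℝ} (h : α < β)

/-! Isotropy is the fundamental theorem of calculus. A two-variable polynomial acts on a pair of
functions with `ζ` differentiating the first and `η` the second, so multiplication by `ζ + η` is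
`d/dz` (`bdf_zeta_add_eta_mul`). The factorization then makes the integrand for two solutions minus
the derivative of their boundary pairing, and the end-point terms cancel the integral
(`extForm_solution_solution`).

Conversely, let `v` be orthogonal to all solutions. Latent variables that vanish to high order at
both ends produce no boundary terms; moving the operators onto `v` by parts yields the differential
equation (`diffOp_eq_zero_of_extForm_solution`). The rank condition gives Bézout identities over
`ℝ[s]`, so the kernel of this equation is the image of `[P; S]` (`exists_image_representation`).
Subtracting the solution found leaves only boundary variables. Minimality makes the rows of `W`
independent over `ℝ`, and polynomial latent variables separate the two ends, so these variables
vanish (`eq_zero_of_boundaryForm_boundaryValue`).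

Non-degeneracy comes from pairing a tuple with a rotated copy of itself, which gives a sum of
squares. -/

/-- Evaluation at a point, as a linear form. -/
def ev (z : ℝ) : Smooth h →ₗ[ℝ] ℝ where
  toFun f := IccExtend h.le f.1 z
  map_add' _ _ := rfl
  map_smul' _ _ := rfl

theorem ev_apply (z : ℝ) (f : Smooth h) : ev h z f = f.1 (projIcc α β h.le z) := rfl

theorem valueAt_apply {ι : Type*} (z : ℝ) (u : ι → Smooth h) (i : ι) :
    valueAt h z u i = ev h z (u i) := rfl

theorem smooth_ext {f g : Smooth h} (H : ∀ z ∈ Icc α β, ev h z f = ev h z g) : f = g := by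
  ext z
  have := H z z.2
  simpa [ev_apply] using this

/-- Pointwise multiplication of smooth functions. -/
def mulS : Smooth h →ₗ[ℝ] Smooth h →ₗ[ℝ] Smooth h :=
  LinearMap.mk₂ ℝ (fun f g => ⟨f.1 * g.1, (ContDiffOn.mul f.2 g.2 :)⟩)
    (fun _ _ _ => Subtype.ext (add_mul _ _ _))
    (fun _ _ _ => Subtype.ext (smul_mul_assoc _ _ _))
    (fun _ _ _ => Subtype.ext (mul_add _ _ _))
    (fun _ _ _ => Subtype.ext (mul_smul_comm _ _ _))

@[simp]
theorem ev_mulS (z : ℝ) (f g : Smooth h) : ev h z (mulS h f g) = ev h z f * ev h z g := rfl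

theorem mulS_comm (f g : Smooth h) : mulS h f g = mulS h g f :=
  Subtype.ext (mul_comm _ _)

theorem D_mulS (f g : Smooth h) :
    D h (mulS h f g) = mulS h (D h f) g + mulS h f (D h g) := by
  ext z
  have hf := (f.2.differentiableOn (by simp)) z z.2
  have hg := (g.2.differentiableOn (by simp)) z z.2
  have := derivWithin_mul hf hg
  rw [IccExtend_of_mem h.le _ z.2, IccExtend_of_mem h.le _ z.2] at this
  exact this

/-- A polynomial function, restricted to the interval. -/
def polyS (q : ℝ[X]) : Smooth h :=
  ⟨fun z => q.eval z.1, by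
    have h1 : ContDiffOn ℝ ∞ (fun z : ℝ => q.eval z) (Icc α β) := by
      simpa using (q.contDiff_aeval ∞ (𝕜 := ℝ)).contDiffOn
    exact h1.congr fun z hz => by rw [IccExtend_of_mem h.le _ hz]⟩

theorem ev_polyS {z : ℝ} (hz : z ∈ Icc α β) (q : ℝ[X]) : ev h z (polyS h q) = q.eval z := by
  rw [ev_apply, projIcc_of_mem h.le hz]; rfl

theorem D_polyS (q : ℝ[X]) : D h (polyS h q) = polyS h (derivative q) := by
  ext z
  change derivWithin (IccExtend h.le (polyS h q).1) (Icc α β) z = _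
  have h1 : derivWithin (IccExtend h.le (polyS h q).1) (Icc α β) z =
      derivWithin (fun z : ℝ => q.eval z) (Icc α β) z := by
    refine derivWithin_congr (fun y hy => ev_polyS h hy q) (ev_polyS h z.2 q)
  rw [h1, (q.hasDerivAt z.1).hasDerivWithinAt.derivWithin (uniqueDiffOn_Icc h z z.2)]
  rfl

theorem pow_D_polyS (k : ℕ) (q : ℝ[X]) : (D h ^ k) (polyS h q) = polyS h (derivative^[k] q) := by
  induction k with
  | zero => simp
  | succ k ih => rw [pow_succ', Module.End.mul_apply, ih, D_polyS, Function.iterate_succ_apply']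

theorem continuous_ev (f : Smooth h) : Continuous fun z => ev h z f :=
  (continuous_apply (0 : Fin 1)).comp (continuous_valueAt h fun _ => f)

theorem hasDerivAt_ev (f : Smooth h) {z : ℝ} (hz : z ∈ Ioo α β) :
    HasDerivAt (fun z => ev h z f) (ev h z (D h f)) z := by
  have h1 := (f.2.differentiableOn (by simp)) z (Ioo_subset_Icc_self hz)
  have h2 := (h1.hasDerivWithinAt).hasDerivAt (Icc_mem_nhds hz.1 hz.2)
  have h3 : ev h z (D h f) = derivWithin (IccExtend h.le f.1) (Icc α β) z := by
    rw [ev_apply, projIcc_of_mem h.le (Ioo_subset_Icc_self hz)]; rfl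
  rw [h3]
  exact h2

/-- The integral of a smooth function over the interval. -/
def integ : Smooth h →ₗ[ℝ] ℝ where
  toFun f := ∫ z in α..β, ev h z f
  map_add' f g := by
    simp only [map_add]
    exact intervalIntegral.integral_add ((continuous_ev h f).intervalIntegrable _ _)
      ((continuous_ev h g).intervalIntegrable _ _)
  map_smul' c f := by
    simp only [map_smul]
    exact intervalIntegral.integral_smul _ _

theorem integ_D (f : Smooth h) : integ h (D h f) = ev h β f - ev h α f :=
  intervalIntegral.integral_eq_sub_of_hasDerivAt_of_le h.le (continuous_ev h f).continuousOn
    (fun _ hz => hasDerivAt_ev h f hz) ((continuous_ev h (D h f)).intervalIntegrable _ _)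

theorem integ_nonneg {f : Smooth h} (hf : ∀ z ∈ Icc α β, 0 ≤ ev h z f) : 0 ≤ integ h f :=
  intervalIntegral.integral_nonneg h.le hf

theorem ev_eq_zero_of_integ_eq_zero {f : Smooth h} (hf : ∀ z ∈ Icc α β, 0 ≤ ev h z f)
    (h0 : integ h f = 0) {z : ℝ} (hz : z ∈ Icc α β) : ev h z f = 0 := by
  by_contra hne
  have hpos := intervalIntegral.integral_pos h (continuous_ev h f).continuousOn
    (fun y hy => hf y (Ioc_subset_Icc_self hy)) ⟨z, hz, lt_of_le_of_ne (hf z hz) (Ne.symm hne)⟩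
  exact hpos.ne' h0

theorem eq_zero_of_ev_Ioo {f : Smooth h} (hf : ∀ z ∈ Ioo α β, ev h z f = 0) : f = 0 := by
  have hcl : IsClosed {z | ev h z f = 0} := isClosed_eq (continuous_ev h f) continuous_const
  have hsub : Icc α β ⊆ {z | ev h z f = 0} := by
    exact (closure_Ioo h.ne).superset.trans (hcl.closure_subset_iff.2 hf)
  exact smooth_ext h fun z hz => by rw [map_zero]; exact hsub hz

theorem integ_mulS_self_nonneg (f : Smooth h) : 0 ≤ integ h (mulS h f f) :=
  integ_nonneg h fun z _ => by rw [ev_mulS]; exact mul_self_nonneg _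

theorem eq_zero_of_integ_mulS_self {f : Smooth h} (hf : integ h (mulS h f f) = 0) : f = 0 :=
  smooth_ext h fun z hz => by
    have := ev_eq_zero_of_integ_eq_zero h (f := mulS h f f)
      (fun z _ => by rw [ev_mulS]; exact mul_self_nonneg _) hf hz
    rw [ev_mulS] at this
    rw [map_zero]
    exact mul_self_eq_zero.1 this

/-! ### Functions vanishing to high order at the end points -/

/-- The weight `(z - α) (β - z)`. -/
def weight (α β : ℝ) : ℝ[X] := (X - C α) * (C β - X)

/-- The function `((z - α) (β - z)) ^ n * u`. -/
def flat (n : ℕ) (u : Smooth h) : Smooth h := mulS h (polyS h (weight α β ^ n)) u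

theorem ev_flat (n : ℕ) (u : Smooth h) {z : ℝ} (hz : z ∈ Icc α β) :
    ev h z (flat h n u) = ((z - α) * (β - z)) ^ n * ev h z u := by
  simp [flat, ev_polyS h hz, weight]

theorem ev_flat_left {n : ℕ} (hn : 0 < n) (u : Smooth h) : ev h α (flat h n u) = 0 := by
  rw [ev_flat h n u (left_mem_Icc.2 h.le)]
  simp [hn.ne']

theorem ev_flat_right {n : ℕ} (hn : 0 < n) (u : Smooth h) : ev h β (flat h n u) = 0 := by
  rw [ev_flat h n u (right_mem_Icc.2 h.le)]
  simp [hn.ne']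

/-- With `w` the weight, `(wⁿ⁺¹ u)' = wⁿ ((n + 1) w' u + w u')`: each derivative costs one power. A
polynomial weight therefore serves as well as a bump function for operators of bounded order. -/
theorem exists_D_flat (n : ℕ) (u : Smooth h) : ∃ v, D h (flat h (n + 1) u) = flat h n v := by
  refine ⟨mulS h (polyS h (C (n + 1 : ℝ) * derivative (weight α β))) u +
    mulS h (polyS h (weight α β)) (D h u), ?_⟩
  rw [flat, D_mulS, D_polyS]
  refine smooth_ext h fun z hz => ?_
  simp only [flat, map_add, ev_mulS, ev_polyS h hz, derivative_pow_succ, eval_mul, eval_pow]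
  ring

theorem exists_pow_D_flat (n k : ℕ) (hk : k ≤ n) (u : Smooth h) :
    ∃ v, (D h ^ k) (flat h n u) = flat h (n - k) v := by
  induction k with
  | zero => exact ⟨u, by simp⟩
  | succ k ih =>
    obtain ⟨v, hv⟩ := ih (by omega)
    obtain ⟨w, hw⟩ := exists_D_flat h (n - (k + 1)) v
    refine ⟨w, ?_⟩
    rw [pow_succ', Module.End.mul_apply, hv, ← hw]
    congr 2
    omega

theorem aeval_D_apply (a : ℝ[X]) (f : Smooth h) :
    aeval (D h) a f = ∑ k ∈ Finset.range (a.natDegree + 1), a.coeff k • (D h ^ k) f := by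
  simp [aeval_eq_sum_range, LinearMap.sum_apply]

theorem ev_aeval_D_flat (a : ℝ[X]) {n : ℕ} (hn : a.natDegree < n) (u : Smooth h) :
    ev h α (aeval (D h) a (flat h n u)) = 0 ∧ ev h β (aeval (D h) a (flat h n u)) = 0 := by
  rw [aeval_D_apply, map_sum, map_sum]
  constructor <;>
  · refine Finset.sum_eq_zero fun k hk => ?_
    rw [Finset.mem_range] at hk
    obtain ⟨v, hv⟩ := exists_pow_D_flat h n k (by omega) u
    rw [map_smul, hv]
    first
    | rw [ev_flat_left h (by omega), smul_zero]
    | rw [ev_flat_right h (by omega), smul_zero]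

/-- Repeated integration by parts. At each step the boundary term still carries a positive power of
the weight. The function `f` is quantified inside the induction because it is replaced by its
derivative. -/
theorem integ_mulS_pow_D_flat (k : ℕ) : ∀ (n : ℕ), k ≤ n → ∀ f u : Smooth h,
    integ h (mulS h f ((D h ^ k) (flat h n u))) =
      integ h (mulS h (((-D h) ^ k) f) (flat h n u)) := by
  induction k with
  | zero => intro n _ f u; simp
  | succ k ih =>
    intro n hn f u
    obtain ⟨v, hv⟩ := exists_pow_D_flat h n k (by omega) u
    have h1 := integ_D h (mulS h f (flat h (n - k) v))
    rw [D_mulS, map_add, ev_mulS, ev_mulS, ev_flat_left h (by omega), ev_flat_right h (by omega),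
      ← hv] at h1
    have h2 := ih n (by omega) (D h f) u
    rw [pow_succ', Module.End.mul_apply, pow_succ, Module.End.mul_apply, LinearMap.neg_apply,
      map_neg, map_neg, LinearMap.neg_apply, map_neg]
    linarith

theorem integ_mulS_aeval_D_flat (a : ℝ[X]) {n : ℕ} (hn : a.natDegree < n) (f u : Smooth h) :
    integ h (mulS h f (aeval (D h) a (flat h n u))) =
      integ h (mulS h (aeval (D h) (a.comp (-X)) f) (flat h n u)) := by
  rw [aeval_comp, map_neg, aeval_X, aeval_D_apply, aeval_eq_sum_range]
  simp only [LinearMap.sum_apply, map_sum, LinearMap.smul_apply, map_smul]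
  refine Finset.sum_congr rfl fun k hk => ?_
  rw [Finset.mem_range] at hk
  rw [integ_mulS_pow_D_flat h k n (by omega)]

/-- The integrand is `wⁿ f²` with `w > 0` in the interior; the end points, where `w` vanishes,
follow by continuity. -/
theorem eq_zero_of_integ_mulS_flat_self (n : ℕ) {f : Smooth h}
    (hf : integ h (mulS h f (flat h n f)) = 0) : f = 0 := by
  have hw : ∀ z ∈ Icc α β, 0 ≤ (z - α) * (β - z) := fun z hz =>
    mul_nonneg (sub_nonneg.2 hz.1) (sub_nonneg.2 hz.2)
  have key : ∀ z ∈ Icc α β, ev h z (mulS h f (flat h n f)) =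
      ((z - α) * (β - z)) ^ n * (ev h z f * ev h z f) := fun z hz => by
    rw [ev_mulS, ev_flat h n f hz]; ring
  refine eq_zero_of_ev_Ioo h fun z hz => ?_
  have hz' := Ioo_subset_Icc_self hz
  have := ev_eq_zero_of_integ_eq_zero h (fun y hy => by
    rw [key y hy]; exact mul_nonneg (pow_nonneg (hw y hy) n) (mul_self_nonneg _)) hf hz'
  rw [key z hz'] at this
  have hpos : 0 < (z - α) * (β - z) := mul_pos (sub_pos.2 hz.1) (sub_pos.2 hz.2)
  exact mul_self_eq_zero.1 ((mul_eq_zero.1 this).resolve_left (pow_pos hpos n).ne')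

theorem integ_mulS_flat_self_nonneg (n : ℕ) (f : Smooth h) :
    0 ≤ integ h (mulS h f (flat h n f)) :=
  integ_nonneg h fun z hz => by
    rw [ev_mulS, ev_flat h n f hz, mul_left_comm]
    exact mul_nonneg (pow_nonneg (mul_nonneg (sub_nonneg.2 hz.1) (sub_nonneg.2 hz.2)) n)
      (mul_self_nonneg _)

/-! ### Values of differential operators on polynomials -/

theorem ev_aeval_D_polyS (a q : ℝ[X]) {z : ℝ} (hz : z ∈ Icc α β) :
    ev h z (aeval (D h) a (polyS h q)) =
      ∑ k ∈ Finset.range (a.natDegree + 1), a.coeff k * (derivative^[k] q).eval z := by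
  rw [aeval_D_apply]
  simp [pow_D_polyS, ev_polyS h hz]

theorem eval_iterate_derivative_X_sub_C_pow_mul (z : ℝ) (n : ℕ) (q : ℝ[X]) {k : ℕ} (hk : k < n) :
    (derivative^[k] ((X - C z) ^ n * q)).eval z = 0 := by
  rw [← IsRoot.def, ← dvd_iff_isRoot]
  have h1 : (X - C z) ^ (n - k) ∣ derivative^[k] ((X - C z) ^ n * q) :=
    pow_sub_dvd_iterate_derivative_of_pow_dvd k (dvd_mul_right _ _)
  exact (dvd_pow_self _ (by omega)).trans h1

theorem eval_iterate_derivative_X_sub_C_pow_mul_self (z : ℝ) (n : ℕ) (q : ℝ[X]) :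
    (derivative^[n] ((X - C z) ^ n * q)).eval z = n.factorial * q.eval z := by
  -- In the Leibniz sum only the term with all `n` derivatives on the power survives at `z`.
  rw [iterate_derivative_mul, eval_finsetSum, Finset.sum_eq_single 0]
  · simp [iterate_derivative_X_sub_pow_self]
  · intro k hk hk0
    rw [eval_smul, eval_mul]
    have := eval_iterate_derivative_X_sub_C_pow_mul z n 1 (k := n - k)
      (by rw [Finset.mem_range] at hk; omega)
    rw [mul_one] at this
    rw [this, zero_mul, smul_zero]
  · simp

/-- A zero of order exactly `deg a` at `z` lets only the leading term of `a` contribute there, while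
a zero of order `deg b + 1` at `z'` kills every term of `b`. -/
theorem exists_ev_aeval_D_ne_zero {z z' : ℝ} (hz : z ∈ Icc α β) (hz' : z' ∈ Icc α β)
    (hzz : z ≠ z') {a : ℝ[X]} (ha : a ≠ 0) (b : ℝ[X]) :
    ∃ f : Smooth h, ev h z (aeval (D h) a f) ≠ 0 ∧ ev h z' (aeval (D h) b f) = 0 := by
  refine ⟨polyS h ((X - C z) ^ a.natDegree * (X - C z') ^ (b.natDegree + 1)), ?_, ?_⟩
  · rw [ev_aeval_D_polyS h _ _ hz, Finset.sum_range_succ, Finset.sum_eq_zero, zero_add,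
      eval_iterate_derivative_X_sub_C_pow_mul_self]
    · refine mul_ne_zero (leadingCoeff_ne_zero.2 ha) (mul_ne_zero (by positivity) ?_)
      simpa [sub_eq_zero] using hzz
    · intro k hk
      rw [Finset.mem_range] at hk
      rw [eval_iterate_derivative_X_sub_C_pow_mul z _ _ hk, mul_zero]
  · rw [ev_aeval_D_polyS h _ _ hz', Finset.sum_eq_zero]
    intro k hk
    rw [Finset.mem_range] at hk
    rw [mul_comm ((X - C z) ^ _), eval_iterate_derivative_X_sub_C_pow_mul z' _ _ hk, mul_zero]

end Calculus

/-! ### Bilinear differential forms -/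

section BilinearDifferentialForms

variable {α β : ℝ} (h : α < β)

/-- The bilinear differential form `∑ Φₖₗ (Dᵏ f) (Dˡ g)` of a two-variable polynomial `Φ`. -/
def bdf (f g : Smooth h) : BiPoly →+ Smooth h where
  toFun Φ := Φ.sum fun l a => mulS h (aeval (D h) a f) ((D h ^ l) g)
  map_zero' := sum_zero_index _
  map_add' Φ Ψ := sum_add_index _ _ _ (by simp) (by simp)

theorem bdf_C_mul_X_pow (f g : Smooth h) (a : ℝ[X]) (l : ℕ) :
    bdf h f g (C a * X ^ l) = mulS h (aeval (D h) a f) ((D h ^ l) g) := by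
  rw [C_mul_X_pow_eq_monomial]
  exact sum_monomial_index a (fun l a => mulS h (aeval (D h) a f) ((D h ^ l) g)) (by simp)

theorem aeval_zeta (a : ℝ[X]) : aeval zeta a = (C a : BiPoly) := by
  have := aeval_algebraMap_apply BiPoly (X : ℝ[X]) a
  rw [aeval_X_left_apply] at this
  exact this

theorem bdf_mul (f g : Smooth h) (a b : ℝ[X]) :
    bdf h f g (aeval zeta a * aeval eta b) = mulS h (aeval (D h) a f) (aeval (D h) b g) := by
  rw [aeval_zeta]
  induction b using Polynomial.induction_on' with
  | add p q hp hq => simp only [map_add, mul_add, hp, hq, LinearMap.add_apply]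
  | monomial l c =>
    rw [aeval_monomial, aeval_monomial]
    have : (C a * (algebraMap ℝ BiPoly c * eta ^ l) : BiPoly) = C (a * C c) * X ^ l := by
      rw [C_mul, mul_assoc]; rfl
    rw [this, bdf_C_mul_X_pow]
    simp [Algebra.smul_def, Module.algebraMap_end_apply]

/-- The Leibniz rule in symbols: `ζ` differentiates the first factor, `η` the second. -/
theorem bdf_zeta_add_eta_mul (f g : Smooth h) (Φ : BiPoly) :
    bdf h f g ((zeta + eta) * Φ) = D h (bdf h f g Φ) := by
  induction Φ using Polynomial.induction_on' with
  | add p q hp hq => simp only [mul_add, map_add, hp, hq]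
  | monomial l a =>
    rw [← C_mul_X_pow_eq_monomial]
    have : ((zeta + eta) * (C a * X ^ l) : BiPoly) = C (X * a) * X ^ l + C a * X ^ (l + 1) := by
      rw [zeta, eta, C_mul]; ring
    rw [this, map_add, bdf_C_mul_X_pow, bdf_C_mul_X_pow, bdf_C_mul_X_pow, D_mulS, map_mul, aeval_X,
      Module.End.mul_apply, pow_succ', Module.End.mul_apply]

/-- The bilinear differential form of a two-variable polynomial matrix. -/
def bdfMatrix {κ : Type*} [Fintype κ] (f g : κ → Smooth h) : Matrix κ κ BiPoly →+ Smooth h where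
  toFun Φ := ∑ i, ∑ j, bdf h (f i) (g j) (Φ i j)
  map_zero' := by simp
  map_add' Φ Ψ := by simp [Finset.sum_add_distrib]

theorem bdfMatrix_smul {κ : Type*} [Fintype κ] (f g : κ → Smooth h) (Φ : Matrix κ κ BiPoly) :
    bdfMatrix h f g ((zeta + eta) • Φ) = D h (bdfMatrix h f g Φ) := by
  simp [bdfMatrix, bdf_zeta_add_eta_mul]

theorem diffOp_apply {ι κ : Type*} [Fintype κ] (M : Matrix ι κ ℝ[X]) (l : κ → Smooth h) (i : ι) :
    diffOp h M l i = ∑ j, aeval (D h) (M i j) (l j) := by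
  simp [diffOp]

theorem bdfMatrix_mul {ι κ : Type*} [Fintype ι] [Fintype κ] (M N : Matrix ι κ ℝ[X])
    (f g : κ → Smooth h) :
    bdfMatrix h f g ((atZeta M)ᵀ * atEta N) = ∑ i, mulS h (diffOp h M f i) (diffOp h N g i) := by
  simp only [bdfMatrix, AddMonoidHom.coe_mk, ZeroHom.coe_mk, Matrix.mul_apply, transpose_apply,
    atZeta, atEta, Matrix.map_apply, map_sum, bdf_mul, diffOp_apply, LinearMap.sum_apply]
  rw [Finset.sum_congr rfl fun i _ => Finset.sum_comm, Finset.sum_comm]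
  refine Finset.sum_congr rfl fun i _ => ?_
  rw [Finset.sum_comm]

theorem diffOp_mul {ι κ μ : Type*} [Fintype κ] [Fintype μ] (M : Matrix ι κ ℝ[X])
    (N : Matrix κ μ ℝ[X]) (l : μ → Smooth h) :
    diffOp h (M * N) l = diffOp h M (diffOp h N l) := by
  ext1 i
  simp only [diffOp_apply, Matrix.mul_apply, map_sum, map_mul, LinearMap.sum_apply,
    Module.End.mul_apply]
  exact Finset.sum_comm

theorem diffOp_add {ι κ : Type*} [Fintype κ] (M N : Matrix ι κ ℝ[X]) (l : κ → Smooth h) :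
    diffOp h (M + N) l = diffOp h M l + diffOp h N l := by
  ext1 i
  simp [diffOp_apply, Finset.sum_add_distrib]

theorem diffOp_one {κ : Type*} [Fintype κ] [DecidableEq κ] (l : κ → Smooth h) :
    diffOp h 1 l = l := by
  ext1 i
  rw [diffOp_apply, Finset.sum_eq_single i]
  · simp
  · intro j _ hj
    simp [Matrix.one_apply_ne (Ne.symm hj)]
  · simp

theorem diffOp_zero {ι κ : Type*} [Fintype κ] (l : κ → Smooth h) :
    diffOp h (0 : Matrix ι κ ℝ[X]) l = 0 := by
  ext1 i
  simp [diffOp_apply]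

end BilinearDifferentialForms

/-! ### Polynomial matrices -/

section PolynomialMatrices

theorem atNeg_mul {ι κ μ : Type*} [Fintype κ] (M : Matrix ι κ ℝ[X]) (N : Matrix κ μ ℝ[X]) :
    atNeg (M * N) = atNeg M * atNeg N := by
  ext1 i j
  simp [atNeg, Matrix.mul_apply, mul_comp]

variable {ι : Type*} [Fintype ι]

/-- A complex matrix of full column rank has an invertible square submatrix. -/
theorem exists_det_submatrix_ne_zero {m : ℕ} (A : Matrix ι (Fin m) ℂ) (hA : A.rank = m) :
    ∃ f : Fin m → ι, (A.submatrix f id).det ≠ 0 := by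
  obtain ⟨σ, a, ha, hs, hl⟩ := exists_linearIndependent' ℂ A.row
  have : Finite σ := Finite.of_injective a ha
  have := Fintype.ofFinite σ
  have hc : Fintype.card σ = m := by
    rw [linearIndependent_iff_card_eq_finrank_span.1 hl, Set.finrank, hs,
      ← A.rank_eq_finrank_span_row, hA]
  let e : Fin m ≃ σ := (Fintype.equivFinOfCardEq hc).symm
  refine ⟨a ∘ e, ?_⟩
  have h1 : LinearIndependent ℂ (A.submatrix (a ∘ e) id).row := hl.comp e e.injective
  exact ((isUnit_iff_isUnit_det _).1 (linearIndependent_rows_iff_isUnit.1 h1)).ne_zero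

/-- A real polynomial matrix of full column rank at every complex point has a polynomial left
inverse. -/
theorem exists_left_inverse {m : ℕ} (A : Matrix ι (Fin m) ℝ[X])
    (hA : ∀ s : ℂ, (evalC A s).rank = m) : ∃ B : Matrix (Fin m) ι ℝ[X], B * A = 1 := by
  classical
  let I : Ideal ℝ[X] := Ideal.span (range fun f : Fin m → ι => (A.submatrix f id).det)
  -- A common complex zero of the maximal minors would contradict full rank there, so the generator
  -- of this principal ideal has no complex root and is a unit.
  have hI : I = ⊤ := by
    obtain ⟨q, hq⟩ := IsPrincipalIdealRing.principal I
    change I = Ideal.span {q} at hq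
    rw [hq, Ideal.span_singleton_eq_top, isUnit_iff_degree_eq_zero]
    by_contra hdeg
    obtain ⟨s, hs⟩ := IsAlgClosed.exists_aeval_eq_zero ℂ q hdeg
    obtain ⟨f, hf⟩ := exists_det_submatrix_ne_zero _ (hA s)
    have hmem : (A.submatrix f id).det ∈ I := Ideal.subset_span ⟨f, rfl⟩
    rw [hq, Ideal.mem_span_singleton] at hmem
    obtain ⟨r, hr⟩ := hmem
    apply hf
    have h1 : (evalC A s).submatrix f id = (A.submatrix f id).map (aeval s : ℝ[X] →ₐ[ℝ] ℂ) := rfl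
    have h2 := AlgHom.map_det (aeval s : ℝ[X] →ₐ[ℝ] ℂ) (A.submatrix f id)
    rw [h1, ← AlgHom.mapMatrix_apply, ← h2, hr, map_mul, hs, zero_mul]
  have key : ∀ r ∈ I, ∃ B : Matrix (Fin m) ι ℝ[X], B * A = r • (1 : Matrix (Fin m) (Fin m) ℝ[X]) := by
    intro r hr
    induction hr using Submodule.span_induction with
    | mem r hr =>
      obtain ⟨f, rfl⟩ := hr
      -- The second factor selects the rows `f`; the adjugate then produces the minor times the
      -- identity.
      refine ⟨(A.submatrix f id).adjugate * (1 : Matrix ι ι ℝ[X]).submatrix f id, ?_⟩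
      rw [Matrix.mul_assoc, ← adjugate_mul]
      congr 1
      ext i j
      simp [Matrix.mul_apply, Matrix.one_apply]
    | zero => exact ⟨0, by simp⟩
    | add r s _ _ hr hs =>
      obtain ⟨B, hB⟩ := hr
      obtain ⟨B', hB'⟩ := hs
      exact ⟨B + B', by rw [Matrix.add_mul, hB, hB', add_smul]⟩
    | smul c r _ hr =>
      obtain ⟨B, hB⟩ := hr
      exact ⟨c • B, by rw [Matrix.smul_mul, hB, smul_smul, smul_eq_mul]⟩
  simpa using key 1 (hI ▸ Submodule.mem_top)

/-- If `B A = 0`, where `A` has a left inverse, `B` has a right inverse, and the sizes match, then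
the sequence given by `A` and `B` is split exact. -/
theorem exists_splitting {R : Type*} [CommRing R] {m : ℕ} {A : Matrix (Fin m ⊕ Fin m) (Fin m) R}
    {B : Matrix (Fin m) (Fin m ⊕ Fin m) R} (hBA : B * A = 0)
    {A' : Matrix (Fin m) (Fin m ⊕ Fin m) R} (hA : A' * A = 1)
    {B' : Matrix (Fin m ⊕ Fin m) (Fin m) R} (hB : B * B' = 1) :
    ∃ A'' : Matrix (Fin m) (Fin m ⊕ Fin m) R, A * A'' + B' * B = 1 := by
  -- The left inverse `A'` is corrected so as to annihilate `B'`. The square matrices `[A''; B]` and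
  -- `[A, B']` are then inverse on one side, hence on both.
  refine ⟨A' - A' * B' * B, ?_⟩
  have h1 : fromRows (A' - A' * B' * B) B * fromCols A B' = 1 := by
    rw [fromRows_mul_fromCols, ← fromBlocks_one, Matrix.sub_mul, Matrix.sub_mul,
      Matrix.mul_assoc _ B A, hBA, Matrix.mul_assoc _ B B', hB, hA]
    simp
  have h2 := mul_eq_one_comm.1 h1
  rwa [fromCols_mul_fromRows] at h2

end PolynomialMatrices

/-! ### Kernel and image representations of the differential equation -/

section Lagrangian

variable {α β : ℝ} (h : α < β) {m p : ℕ}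

theorem evalC_mul {ι κ μ : Type*} [Fintype κ] (M : Matrix ι κ ℝ[X]) (N : Matrix κ μ ℝ[X]) (s : ℂ) :
    evalC (M * N) s = evalC M s * evalC N s := by
  ext1 i j
  simp [evalC, Matrix.mul_apply]

theorem evalC_fromRows {ι ι' κ : Type*} (M : Matrix ι κ ℝ[X]) (N : Matrix ι' κ ℝ[X]) (s : ℂ) :
    evalC (fromRows M N) s = fromRows (evalC M s) (evalC N s) := by
  ext1 i j
  rcases i with i | i <;> rfl

theorem eq_zero_of_evalC {ι κ : Type*} {M : Matrix ι κ ℝ[X]} (hM : ∀ s : ℂ, evalC M s = 0) :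
    M = 0 := by
  ext1 i j
  have h1 : (M i j).map (algebraMap ℝ ℂ) = 0 := Polynomial.funext fun s => by
    rw [eval_map_algebraMap, eval_zero]
    exact congrFun₂ (hM s) i j
  exact (Polynomial.map_eq_zero _).1 h1

/-- The matrix `[Sᵀ(-s), -Pᵀ(-s)]`. -/
def dualMatrix (P S : Matrix (Fin m) (Fin m) ℝ[X]) : Matrix (Fin m) (Fin m ⊕ Fin m) ℝ[X] :=
  fromCols (atNeg S)ᵀ (-(atNeg P)ᵀ)

variable {P S : Matrix (Fin m) (Fin m) ℝ[X]} {W : Matrix (Fin p ⊕ Fin p) (Fin m) ℝ[X]}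

/-- Up to sign this is the symmetry hypothesis, which passes from all complex points to an identity
of polynomials. -/
theorem dualMatrix_mul (hPS : IsLagrangianPair P S) : dualMatrix P S * fromRows P S = 0 := by
  refine eq_zero_of_evalC fun s => ?_
  have h1 := hPS.symm s
  rw [canonJ, fromCols_mul_fromBlocks, fromCols_mul_fromRows] at h1
  simp only [Matrix.mul_zero, Matrix.mul_one, zero_add, add_zero, Matrix.mul_neg,
    Matrix.neg_mul] at h1
  have h2 : evalC (dualMatrix P S) s = fromCols (evalC S (-s))ᵀ (-(evalC P (-s))ᵀ) := by
    ext1 i j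
    rcases j with j | j <;> simp [dualMatrix, evalC, atNeg, aeval_comp]
  rw [evalC_mul, h2, evalC_fromRows, fromCols_mul_fromRows, ← neg_eq_zero, ← h1, Matrix.neg_mul]
  abel

/-- Multiplying `[Sᵀ(-s), -Pᵀ(-s)]` by the symplectic matrix gives the transpose of `[P; S]` at
`-s`, so transposing a left inverse of `[P; S]` gives a right inverse here. -/
theorem exists_dualMatrix_right_inverse {A' : Matrix (Fin m) (Fin m ⊕ Fin m) ℝ[X]}
    (hA : A' * fromRows P S = 1) :
    ∃ B' : Matrix (Fin m ⊕ Fin m) (Fin m) ℝ[X], dualMatrix P S * B' = 1 := by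
  refine ⟨canonJ m ℝ[X] * (atNeg A')ᵀ, ?_⟩
  have h1 : dualMatrix P S * canonJ m ℝ[X] = (atNeg (fromRows P S))ᵀ := by
    rw [dualMatrix, canonJ, fromCols_mul_fromBlocks]
    ext1 i j
    rcases j with j | j <;> simp [atNeg]
  rw [← Matrix.mul_assoc, h1, ← transpose_mul, ← atNeg_mul, hA]
  ext1 i j
  by_cases hij : i = j <;> simp [atNeg, Matrix.one_apply, hij, eq_comm]

theorem diffOp_fromRows {κ ι ι' : Type*} [Fintype κ] (M : Matrix ι κ ℝ[X]) (N : Matrix ι' κ ℝ[X])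
    (l : κ → Smooth h) :
    diffOp h (fromRows M N) l = Sum.elim (diffOp h M l) (diffOp h N l) := by
  ext1 i
  rcases i with i | i <;> simp [diffOp_apply]

theorem diffOp_dualMatrix (x e : Fin m → Smooth h) :
    diffOp h (dualMatrix P S) (Sum.elim x e) =
      diffOp h (atNeg S)ᵀ x - diffOp h (atNeg P)ᵀ e := by
  ext1 i
  simp [diffOp_apply, dualMatrix, Fintype.sum_sum_type, sub_eq_add_neg]

/-- On smooth functions on an interval, the kernel of `[Sᵀ(-d/dz), -Pᵀ(-d/dz)]` is the image of
`[P(d/dz); S(d/dz)]`. -/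
theorem exists_image_representation (hPS : IsLagrangianPair P S) {x e : Fin m → Smooth h}
    (hxe : diffOp h (atNeg S)ᵀ x - diffOp h (atNeg P)ᵀ e = 0) :
    ∃ l, x = diffOp h P l ∧ e = diffOp h S l := by
  obtain ⟨A', hA'⟩ := exists_left_inverse (fromRows P S) fun s => by
    rw [evalC_fromRows]
    exact hPS.rank s
  obtain ⟨B', hB'⟩ := exists_dualMatrix_right_inverse hA'
  obtain ⟨A'', hA''⟩ := exists_splitting (dualMatrix_mul hPS) hA' hB'
  refine ⟨diffOp h A'' (Sum.elim x e), ?_⟩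
  have h1 := congrArg (fun M => diffOp h M (Sum.elim x e)) hA''
  simp only [diffOp_add, diffOp_mul, diffOp_one, diffOp_dualMatrix, hxe, map_zero, add_zero,
    diffOp_fromRows] at h1
  exact ⟨funext fun i => (congrFun h1 (Sum.inl i)).symm,
    funext fun i => (congrFun h1 (Sum.inr i)).symm⟩

/-! ### The form in terms of differential operators -/

theorem integralForm_apply (u v : (Fin m → Smooth h) × (Fin m → Smooth h)) :
    integralForm h m u v =
      integ h (∑ i, mulS h (u.2 i) (v.1 i) - ∑ i, mulS h (v.2 i) (u.1 i)) := by
  change (∫ z in α..β, density h u v z) = ∫ z in α..β, ev h z _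
  simp [density, dotProduct, valueAt_apply]

theorem extForm_apply (v w : ExtSpace h m p) :
    extForm h m p v w = integralForm h m v.1 w.1 + boundaryForm p v.2.2 w.2.2 -
      boundaryForm p v.2.1 w.2.1 := rfl

theorem boundaryForm_apply (b c : (Fin p → ℝ) × (Fin p → ℝ)) :
    boundaryForm p b c = b.1 ⬝ᵥ c.2 - b.2 ⬝ᵥ c.1 := rfl

theorem boundaryPoly_eq (W : Matrix (Fin p ⊕ Fin p) (Fin m) ℝ[X]) :
    boundaryPoly W = (atZeta W.toRows₁)ᵀ * atEta W.toRows₂ -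
      (atZeta W.toRows₂)ᵀ * atEta W.toRows₁ := by
  have h1 : atZeta W = fromRows (atZeta W.toRows₁) (atZeta W.toRows₂) := by
    ext1 i j
    rcases i with i | i <;> rfl
  have h2 : atEta W = fromRows (atEta W.toRows₁) (atEta W.toRows₂) := by
    ext1 i j
    rcases i with i | i <;> rfl
  rw [boundaryPoly, h1, h2, transpose_fromRows, canonJ, fromCols_mul_fromBlocks,
    fromCols_mul_fromRows]
  simp only [Matrix.mul_zero, Matrix.mul_one, zero_add, add_zero, Matrix.mul_neg, Matrix.neg_mul]
  abel

/-- The value at `z` of the boundary variables generated by `l`. -/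
def boundaryValue (W : Matrix (Fin p ⊕ Fin p) (Fin m) ℝ[X]) (l : Fin m → Smooth h) (z : ℝ) :
    (Fin p → ℝ) × (Fin p → ℝ) :=
  (valueAt h z (diffOp h W.toRows₁ l), valueAt h z (diffOp h W.toRows₂ l))

/-- The tuple generated by the latent variable `l`. -/
def solution (P S : Matrix (Fin m) (Fin m) ℝ[X]) (W : Matrix (Fin p ⊕ Fin p) (Fin m) ℝ[X])
    (l : Fin m → Smooth h) : ExtSpace h m p :=
  ((diffOp h P l, diffOp h S l), boundaryValue h W l α, boundaryValue h W l β)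

theorem elim_boundaryValue (l : Fin m → Smooth h) (z : ℝ) :
    Sum.elim (boundaryValue h W l z).1 (boundaryValue h W l z).2 = valueAt h z (diffOp h W l) := by
  ext i
  rcases i with i | i <;> simp [boundaryValue, valueAt_apply, diffOp_apply, toRows₁, toRows₂]

/-- The differential equation in the definition holds automatically for images of a latent variable,
by `dualMatrix_mul`. -/
theorem mem_solutionSpace_iff (hPS : IsLagrangianPair P S) (v : ExtSpace h m p) :
    v ∈ solutionSpace h P S W ↔ ∃ l, v = solution h P S W l := by
  constructor
  · rintro ⟨-, l, h1, h2, h3, h4⟩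
    rw [← elim_boundaryValue, Sum.elim_eq_iff] at h3 h4
    exact ⟨l, Prod.ext (Prod.ext h1 h2) (Prod.ext (Prod.ext h3.1 h3.2) (Prod.ext h4.1 h4.2))⟩
  · rintro ⟨l, rfl⟩
    refine ⟨?_, l, rfl, rfl, elim_boundaryValue h l α, elim_boundaryValue h l β⟩
    have := congrArg (fun M => diffOp h M l) (dualMatrix_mul hPS)
    simp only [diffOp_mul, diffOp_fromRows, diffOp_dualMatrix, diffOp_zero] at this
    exact this

theorem ev_bdfMatrix_boundaryPoly (l k : Fin m → Smooth h) (z : ℝ) :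
    ev h z (bdfMatrix h l k (boundaryPoly W)) =
      boundaryForm p (boundaryValue h W l z) (boundaryValue h W k z) := by
  rw [boundaryPoly_eq, map_sub, bdfMatrix_mul, bdfMatrix_mul]
  simp [boundaryForm_apply, boundaryValue, dotProduct, valueAt_apply]

theorem extForm_solution_solution (hW : IsMinimalFactorization P S W) (l k : Fin m → Smooth h) :
    extForm h m p (solution h P S W l) (solution h P S W k) = 0 := by
  have h1 := congrArg (bdfMatrix h l k) hW.eq
  rw [bdfMatrix_smul, map_sub, bdfMatrix_mul, bdfMatrix_mul] at h1
  have h2 := integ_D h (bdfMatrix h l k (boundaryPoly W))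
  rw [← h1, ev_bdfMatrix_boundaryPoly, ev_bdfMatrix_boundaryPoly, map_sub] at h2
  rw [extForm_apply, integralForm_apply, map_sub]
  simp only [solution]
  have h3 : ∑ i, mulS h (diffOp h S k i) (diffOp h P l i) =
      ∑ i, mulS h (diffOp h P l i) (diffOp h S k i) :=
    Finset.sum_congr rfl fun i _ => mulS_comm h _ _
  rw [h3]
  linarith

/-! ### The orthogonal companion -/

theorem sum_integ_mulS_diffOp_flat {ι κ : Type*} [Fintype ι] [Fintype κ] (M : Matrix ι κ ℝ[X])
    {n : ℕ} (hn : ∀ i j, (M i j).natDegree < n) (x : ι → Smooth h) (f : κ → Smooth h) :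
    ∑ i, integ h (mulS h (x i) (diffOp h M (fun j => flat h n (f j)) i)) =
      ∑ j, integ h (mulS h (diffOp h (atNeg M)ᵀ x j) (flat h n (f j))) := by
  simp only [diffOp_apply, map_sum, LinearMap.sum_apply]
  rw [Finset.sum_comm]
  refine Finset.sum_congr rfl fun j _ => Finset.sum_congr rfl fun i _ => ?_
  exact integ_mulS_aeval_D_flat h _ (hn i j) _ _

theorem valueAt_diffOp_flat {ι κ : Type*} [Fintype κ] (M : Matrix ι κ ℝ[X])
    {n : ℕ} (hn : ∀ i j, (M i j).natDegree < n) (f : κ → Smooth h) :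
    valueAt h α (diffOp h M fun j => flat h n (f j)) = 0 ∧
      valueAt h β (diffOp h M fun j => flat h n (f j)) = 0 := by
  constructor <;>
  · ext1 i
    rw [valueAt_apply, diffOp_apply, map_sum]
    exact Finset.sum_eq_zero fun j _ => by
      first
      | exact (ev_aeval_D_flat h _ (hn i j) _).1
      | exact (ev_aeval_D_flat h _ (hn i j) _).2

/-- The "eventually" form allows one `n` to serve `P`, `S` and `W` together. -/
theorem exists_degree_bound {ι κ : Type*} [Finite ι] [Finite κ] (M : Matrix ι κ ℝ[X]) :
    ∀ᶠ n in Filter.atTop, ∀ i j, (M i j).natDegree < n :=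
  Filter.eventually_all.2 fun _ => Filter.eventually_all.2 fun _ =>
    Filter.eventually_gt_atTop _

theorem diffOp_eq_zero_of_extForm_solution {v : ExtSpace h m p}
    (hv : ∀ l, extForm h m p (solution h P S W l) v = 0) :
    diffOp h (atNeg S)ᵀ v.1.1 - diffOp h (atNeg P)ᵀ v.1.2 = 0 := by
  obtain ⟨n, ⟨hP, hS⟩, hW⟩ :=
    (((exists_degree_bound P).and (exists_degree_bound S)).and (exists_degree_bound W)).exists
  set f := diffOp h (atNeg S)ᵀ v.1.1 - diffOp h (atNeg P)ᵀ v.1.2 with hf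
  -- Testing with the residual `f` itself times `wⁿ` removes the boundary terms and, after
  -- integration by parts, leaves `∫ wⁿ |f|² = 0`.
  have h1 := hv fun j => flat h n (f j)
  have hW₁ := valueAt_diffOp_flat h W.toRows₁ (fun i j => hW (Sum.inl i) j) f
  have hW₂ := valueAt_diffOp_flat h W.toRows₂ (fun i j => hW (Sum.inr i) j) f
  simp only [extForm_apply, integralForm_apply, boundaryForm_apply, solution, boundaryValue,
    hW₁, hW₂, zero_dotProduct, sub_zero, add_zero, map_sub, map_sum] at h1
  simp only [mulS_comm h (diffOp h S _ _)] at h1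
  rw [sum_integ_mulS_diffOp_flat h S hS, sum_integ_mulS_diffOp_flat h P hP,
    ← Finset.sum_sub_distrib] at h1
  have h2 : ∑ j, integ h (mulS h (f j) (flat h n (f j))) = 0 := by
    rw [← h1]
    refine Finset.sum_congr rfl fun j _ => ?_
    rw [hf, Pi.sub_apply, map_sub, LinearMap.sub_apply, map_sub]
  rw [Finset.sum_eq_zero_iff_of_nonneg fun j _ => integ_mulS_flat_self_nonneg h n (f j)] at h2
  exact funext fun j => eq_zero_of_integ_mulS_flat_self h n (h2 j (Finset.mem_univ j))

/-! ### Minimality and the independence of boundary values -/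

theorem coeff_coeff_aeval_zeta_mul_aeval_eta (a b : ℝ[X]) (k l : ℕ) :
    ((aeval zeta a * aeval eta b : BiPoly).coeff l).coeff k = a.coeff k * b.coeff l := by
  have hb : aeval eta b = b.map (algebraMap ℝ ℝ[X]) := by
    rw [eta, aeval_X_left_eq_map]
  rw [aeval_zeta, hb, coeff_C_mul, coeff_map, algebraMap_eq, coeff_mul_C]

/-- The linear combinations of the rows of the coefficient matrix of `W`. -/
def rowCombination (W : Matrix (Fin p ⊕ Fin p) (Fin m) ℝ[X]) :
    (Fin p ⊕ Fin p → ℝ) →ₗ[ℝ] (ℕ × Fin m → ℝ) :=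
  LinearMap.pi fun b => ∑ i, (W i b.2).coeff b.1 • LinearMap.proj i

theorem rowCombination_apply (c : Fin p ⊕ Fin p → ℝ) (b : ℕ × Fin m) :
    rowCombination W c b = ∑ i, (W i b.2).coeff b.1 * c i := by
  simp [rowCombination]

/-- If `V` is the coefficient matrix of `W`, that of `Wᵀ(ζ) J W(η)` is `Vᵀ J V`; each column is thus
`Vᵀ` applied to a column of `J V`. -/
theorem col_coeffMatrix_boundaryPoly (b : ℕ × Fin m) :
    (coeffMatrix (boundaryPoly W)).col b = rowCombination W
      (Sum.elim (fun i => (W.toRows₂ i b.2).coeff b.1) fun i => -(W.toRows₁ i b.2).coeff b.1) := by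
  ext a
  rw [rowCombination_apply, col_apply, coeffMatrix, of_apply, boundaryPoly_eq]
  simp only [Matrix.sub_apply, Matrix.mul_apply, transpose_apply, atZeta, atEta, Matrix.map_apply,
    coeff_sub, finsetSum_coeff, coeff_coeff_aeval_zeta_mul_aeval_eta, Fintype.sum_sum_type,
    Sum.elim_inl, Sum.elim_inr, mul_neg, Finset.sum_neg_distrib]
  rw [sub_eq_add_neg]
  rfl

/-- The rows of `W` in a minimal factorization are linearly independent over `ℝ`. -/
theorem IsMinimalFactorization.eq_zero_of_sum_smul (hW : IsMinimalFactorization P S W)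
    {c : Fin p ⊕ Fin p → ℝ} (hc : ∀ j, ∑ i, c i • W i j = 0) : c = 0 := by
  -- The column space lies in the range of a map from a space of dimension `2p`. Minimality forces
  -- that range to have dimension `2p`, so the map is injective.
  have h1 : (coeffMatrix (boundaryPoly W)).cRank ≤ Module.rank ℝ (rowCombination W).range := by
    refine Submodule.rank_mono (Submodule.span_le.2 ?_)
    rintro _ ⟨b, rfl⟩
    rw [col_coeffMatrix_boundaryPoly]
    exact LinearMap.mem_range_self _ _
  rw [hW.minimal, ← Module.finrank_eq_rank, Nat.cast_le] at h1
  have h2 := (rowCombination W).finrank_range_add_finrank_ker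
  rw [Module.finrank_fintype_fun_eq_card, Fintype.card_sum, Fintype.card_fin] at h2
  have h3 : Module.finrank ℝ (rowCombination W).ker = 0 := by omega
  rw [Submodule.finrank_eq_zero] at h3
  have h4 : c ∈ (rowCombination W).ker := by
    rw [LinearMap.mem_ker]
    ext b
    have := congrArg (fun q => q.coeff b.1) (hc b.2)
    simpa [rowCombination_apply, mul_comm] using this
  rwa [h3, Submodule.mem_bot] at h4

/-- The row of the differential operator `l ↦ boundaryForm p (W(d/dz) l) c`. -/
def boundaryRow (W : Matrix (Fin p ⊕ Fin p) (Fin m) ℝ[X]) (c : (Fin p → ℝ) × (Fin p → ℝ))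
    (j : Fin m) : ℝ[X] :=
  ∑ i, (Sum.elim c.2 (-c.1) : Fin p ⊕ Fin p → ℝ) i • W i j

theorem boundaryForm_boundaryValue_single (c : (Fin p → ℝ) × (Fin p → ℝ)) (j : Fin m)
    (f : Smooth h) (z : ℝ) :
    boundaryForm p (boundaryValue h W (Pi.single j f) z) c =
      ev h z (aeval (D h) (boundaryRow W c j) f) := by
  have h1 : ∀ (M : Matrix (Fin p) (Fin m) ℝ[X]) (i : Fin p),
      diffOp h M (Pi.single j f) i = aeval (D h) (M i j) f := fun M i => by
    rw [diffOp_apply, Finset.sum_eq_single j]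
    · simp
    · intro k _ hk
      simp [hk]
    · simp
  simp only [boundaryForm_apply, boundaryValue, dotProduct, valueAt_apply, h1, boundaryRow,
    map_sum, LinearMap.sum_apply, Fintype.sum_sum_type, map_smul, LinearMap.smul_apply, map_add,
    LinearMap.add_apply, Sum.elim_inl, Sum.elim_inr, smul_eq_mul, Pi.neg_apply, neg_mul,
    Finset.sum_neg_distrib, sub_eq_add_neg, mul_comm (ev h z _)]
  rfl

theorem eq_zero_of_boundaryRow_eq_zero (hW : IsMinimalFactorization P S W)
    {c : (Fin p → ℝ) × (Fin p → ℝ)} (hc : ∀ j, boundaryRow W c j = 0) : c = 0 := by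
  have h1 := hW.eq_zero_of_sum_smul hc
  refine Prod.ext (funext fun i => ?_) (funext fun i => congrFun h1 (Sum.inl i))
  simpa using congrFun h1 (Sum.inr i)

/-- The boundary values at both end points can be prescribed independently. -/
theorem eq_zero_of_boundaryForm_boundaryValue (hW : IsMinimalFactorization P S W)
    {a b : (Fin p → ℝ) × (Fin p → ℝ)}
    (hab : ∀ l, boundaryForm p (boundaryValue h W l β) b =
      boundaryForm p (boundaryValue h W l α) a) : a = 0 ∧ b = 0 := by
  have hα := left_mem_Icc.2 h.le
  have hβ := right_mem_Icc.2 h.le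
  constructor
  · refine eq_zero_of_boundaryRow_eq_zero hW fun j => ?_
    by_contra hj
    -- A latent variable in the single component `j` makes the pairing nonzero at `α` and zero at
    -- `β`, contradicting `hab`.
    obtain ⟨f, hf, hf'⟩ := exists_ev_aeval_D_ne_zero h hα hβ h.ne hj (boundaryRow W b j)
    have := hab (Pi.single j f)
    rw [boundaryForm_boundaryValue_single, boundaryForm_boundaryValue_single, hf'] at this
    exact hf this.symm
  · refine eq_zero_of_boundaryRow_eq_zero hW fun j => ?_
    by_contra hj
    obtain ⟨f, hf, hf'⟩ := exists_ev_aeval_D_ne_zero h hβ hα h.ne' hj (boundaryRow W a j)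
    have := hab (Pi.single j f)
    rw [boundaryForm_boundaryValue_single, boundaryForm_boundaryValue_single, hf'] at this
    exact hf this

theorem exists_eq_solution_of_extForm (hPS : IsLagrangianPair P S)
    (hW : IsMinimalFactorization P S W) {v : ExtSpace h m p}
    (hv : ∀ l, extForm h m p (solution h P S W l) v = 0) : ∃ l, v = solution h P S W l := by
  obtain ⟨l, hx, he⟩ :=
    exists_image_representation h hPS (diffOp_eq_zero_of_extForm_solution h hv)
  refine ⟨l, ?_⟩
  have h1 : ∀ k, extForm h m p (solution h P S W k) (v - solution h P S W l) = 0 := fun k => by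
    rw [map_sub, hv, extForm_solution_solution h hW, sub_zero]
  have h2 : (v - solution h P S W l).1 = 0 := Prod.ext (sub_eq_zero.2 hx) (sub_eq_zero.2 he)
  simp only [extForm_apply, h2, map_zero, zero_add, sub_eq_zero] at h1
  obtain ⟨ha, hb⟩ := eq_zero_of_boundaryForm_boundaryValue h hW h1
  exact sub_eq_zero.1 (Prod.ext h2 (Prod.ext ha hb))

/-! ### Non-degeneracy -/

theorem isAlt_extForm (m p : ℕ) : (extForm h m p).IsAlt := fun v => by
  rw [extForm_apply, integralForm_apply, boundaryForm_apply, boundaryForm_apply, dotProduct_comm,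
    dotProduct_comm v.2.1.1]
  simp

theorem nondegenerate_extForm (m p : ℕ) : (extForm h m p).Nondegenerate := by
  have hrefl := (isAlt_extForm h m p).isRefl
  have hleft : (extForm h m p).SeparatingLeft := by
    intro v hv
    -- The rotation at `β` has the opposite sign because the form uses opposite sign conventions in
    -- the integral and in the boundary term at `β`; all six contributions become squared norms.
    have h1 := hv ((v.1.2, -v.1.1), (v.2.1.2, -v.2.1.1), (-v.2.2.2, v.2.2.1))
    simp only [extForm_apply, integralForm_apply, boundaryForm_apply, Pi.neg_apply, map_neg,
      LinearMap.neg_apply, Finset.sum_neg_distrib, sub_neg_eq_add, map_add, map_sum,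
      dotProduct_neg] at h1
    have hx : 0 ≤ ∑ i, integ h (mulS h (v.1.1 i) (v.1.1 i)) :=
      Finset.sum_nonneg fun i _ => integ_mulS_self_nonneg h _
    have he : 0 ≤ ∑ i, integ h (mulS h (v.1.2 i) (v.1.2 i)) :=
      Finset.sum_nonneg fun i _ => integ_mulS_self_nonneg h _
    have hd : ∀ c : Fin p → ℝ, 0 ≤ c ⬝ᵥ c := fun c =>
      Finset.sum_nonneg fun i _ => mul_self_nonneg _
    have ha₁ := hd v.2.1.1
    have ha₂ := hd v.2.1.2
    have hb₁ := hd v.2.2.1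
    have hb₂ := hd v.2.2.2
    have hzero : ∀ f : Fin m → Smooth h, ∑ i, integ h (mulS h (f i) (f i)) = 0 → f = 0 := by
      intro f hf
      rw [Finset.sum_eq_zero_iff_of_nonneg fun i _ => integ_mulS_self_nonneg h (f i)] at hf
      exact funext fun i => eq_zero_of_integ_mulS_self h (hf i (Finset.mem_univ i))
    exact Prod.ext (Prod.ext (hzero _ (by linarith)) (hzero _ (by linarith)))
      (Prod.ext (Prod.ext (dotProduct_self_eq_zero.1 (by linarith))
          (dotProduct_self_eq_zero.1 (by linarith)))
        (Prod.ext (dotProduct_self_eq_zero.1 (by linarith))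
          (dotProduct_self_eq_zero.1 (by linarith))))
  exact ⟨hleft, fun w hw => hleft w fun v => hrefl _ _ (hw v)⟩

end Lagrangian

end DiffLagrangian

end

theorem proposition7 {m p : ℕ} (P S : Matrix (Fin m) (Fin m) (Polynomial ℝ))
    (hPS : DiffLagrangian.IsLagrangianPair P S)
    (W : Matrix (Fin p ⊕ Fin p) (Fin m) (Polynomial ℝ))
    (hW : DiffLagrangian.IsMinimalFactorization P S W)
    {α β : ℝ} (hαβ : α < β) :
    DiffLagrangian.IsLagrangian (DiffLagrangian.extForm hαβ m p)
      (DiffLagrangian.solutionSpace hαβ P S W) := by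
  refine ⟨DiffLagrangian.isAlt_extForm hαβ m p, DiffLagrangian.nondegenerate_extForm hαβ m p, ?_⟩
  ext v
  rw [LinearMap.BilinForm.mem_orthogonal_iff]
  constructor
  · intro hv w hw
    obtain ⟨l, rfl⟩ := (DiffLagrangian.mem_solutionSpace_iff hαβ hPS v).1 hv
    obtain ⟨k, rfl⟩ := (DiffLagrangian.mem_solutionSpace_iff hαβ hPS w).1 hw
    exact DiffLagrangian.extForm_solution_solution hαβ hW k l
  · intro hv
    exact (DiffLagrangian.mem_solutionSpace_iff hαβ hPS v).2
      (DiffLagrangian.exists_eq_solution_of_extForm hαβ hPS hW fun l =>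
        hv _ ((DiffLagrangian.mem_solutionSpace_iff hαβ hPS _).2 ⟨l, rfl⟩))
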